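/- Let $\sigma:\Sigma^+\to\Sigma^+$ be a one-sided topologically mixing subshift of finite type over a finite alphabet. Fix $0<\lambda<1$ and let $d(x,y)=\lambda^{n}$ with $n=\min\{k\ge 0 : x_k\neq y_k\}$ for $x\ne y$, and $d(x,x)=0$. For $\gamma>0$ let $C^\gamma(\Sigma^+,\mathbb R)$ be the space of $\gamma$-Hölder functions $A:\Sigma^+\to\mathbb R$, with the norm $$\|A\|_\gamma=\sup_{0<d(x,y)\le 1}\frac{|A(x)-A(y)|}{d(x,y)^\gamma}+\sup_{x}|A(x)|,$$ and let $C^\gamma_0(\Sigma^+,\mathbb R)$ be the subset of those $A$ with topological pressure $P(A)=0$. Let $0<\alpha\le 1$ and let $C^{\alpha+}_0(\Sigma^+,\mathbb R)$ be the closure of $\bigcup_{\gamma>\alpha}C^\gamma_0(\Sigma^+,\mathbb R)$ in $C^\alpha(\Sigma^+,\mathbb R)$ for the norm $\|\cdot\|_\alpha$, with the induced topology. A maximizing measure for $A$ is a $\sigma$-invariant Borel probability measure that maximizes $\nu\mapsto\int A\,d\nu$ among all $\sigma$-invariant Borel probability measures. For a point $p$ with $\sigma^N p=p$, $N\ge 1$,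 let $\nu_p=\frac1N\sum_{k=0}^{N-1}\delta_{\sigma^k p}$. **Theorem B.** Let $\mathcal G_2$ be the set of all $A\in C^{\alpha+}_0(\Sigma^+,\mathbb R)$ for which there are a periodic point $p\in\Sigma^+$ and a neighbourhood $\mathcal U$ of $A$ in $C^{\alpha+}_0(\Sigma^+,\mathbb R)$ such that, for every $B\in\mathcal U$, $\nu_p$ is the unique maximizing measure for $B$. Then $\mathcal G_2$ is open and dense in $C^{\alpha+}_0(\Sigma^+,\mathbb R)$. -/

import Mathlib

open MeasureTheory Filter Topology SymbolicDynamics.FullShift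

noncomputable section

namespace HolderShift

/-! ### One-sided subshifts of finite type -/

variable {S : Type*} [TopologicalSpace S]

/-- A one-sided subshift (a closed, shift-invariant set of sequences `x₀ x₁ x₂ …`) is of finite
type if it is given by finitely many forbidden finite patterns. -/
def IsFiniteType [Inhabited S] (Y : Subshift S ℕ) : Prop :=
  ∃ F : Set (Pattern S ℕ), F.Finite ∧ Y.carrier = forbidden F

/-- The shift map `(x₀, x₁, x₂, …) ↦ (x₁, x₂, x₃, …)` on a one-sided subshift. -/
def sigma (Y : Subshift S ℕ) : Y.carrier → Y.carrier :=
  (Y.mapsTo 1).restrict (shift (1 : ℕ)) Y.carrier Y.carrier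

/-- Topological mixing: for all nonempty open sets `U`, `V`, one has `f^n(U) ∩ V ≠ ∅` for all
large `n`. -/
def TopologicallyMixing {X : Type*} [TopologicalSpace X] (f : X → X) : Prop :=
  ∀ U V : Set X, IsOpen U → IsOpen V → U.Nonempty → V.Nonempty →
    ∃ N : ℕ, ∀ n ≥ N, (f^[n] '' U ∩ V).Nonempty

open Classical in
/-- The distance `d(x, y) = lam ^ n`, where `n` is the first index with `x n ≠ y n`, and
`d(x, x) = 0`. -/
def symDist {Y : Subshift S ℕ} (lam : ℝ) (x y : Y.carrier) : ℝ :=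
  if x = y then 0 else lam ^ PiNat.firstDiff (E := fun _ => S) x.1 y.1

theorem symDist_nonneg {Y : Subshift S ℕ} {lam : ℝ} (h0 : 0 < lam) (x y : Y.carrier) :
    0 ≤ symDist lam x y := by
  unfold symDist
  split_ifs <;> positivity

theorem symDist_le_one {Y : Subshift S ℕ} {lam : ℝ} (h0 : 0 < lam) (h1 : lam < 1)
    (x y : Y.carrier) : symDist lam x y ≤ 1 := by
  unfold symDist
  split_ifs
  · exact zero_le_one
  · exact pow_le_one₀ h0.le h1.le

/-! ### Hölder functions with the Hölder norm -/

/-- The bounded `α`-Hölder functions on a subshift, with respect to `symDist lam`. For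
`0 < lam < 1` and `0 ≤ α` boundedness is automatic, see `mem_holderSubmodule_iff`. -/
def holderSubmodule (Y : Subshift S ℕ) (lam α : ℝ) : Submodule ℝ (Y.carrier → ℝ) where
  carrier := {A | (∃ M : ℝ, ∀ x, |A x| ≤ M) ∧
    ∃ C : ℝ, ∀ x y, |A x - A y| ≤ C * symDist lam x y ^ α}
  zero_mem' := ⟨⟨0, by simp⟩, ⟨0, by simp⟩⟩
  add_mem' := by
    rintro A B ⟨⟨M, hM⟩, ⟨C, hC⟩⟩ ⟨⟨M', hM'⟩, ⟨C', hC'⟩⟩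
    refine ⟨⟨M + M', fun x => (abs_add_le _ _).trans (add_le_add (hM x) (hM' x))⟩,
      ⟨C + C', fun x y => ?_⟩⟩
    calc |(A + B) x - (A + B) y| = |(A x - A y) + (B x - B y)| := by
          congr 1; simp only [Pi.add_apply]; ring
      _ ≤ |A x - A y| + |B x - B y| := abs_add_le _ _
      _ ≤ (C + C') * symDist lam x y ^ α := by linarith [hC x y, hC' x y]
  smul_mem' := by
    rintro c A ⟨⟨M, hM⟩, ⟨C, hC⟩⟩
    refine ⟨⟨|c| * M, fun x => ?_⟩, ⟨|c| * C, fun x y => ?_⟩⟩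
    · simpa [abs_mul] using mul_le_mul_of_nonneg_left (hM x) (abs_nonneg c)
    · simpa [abs_mul, ← mul_sub, mul_assoc] using
        mul_le_mul_of_nonneg_left (hC x y) (abs_nonneg c)

theorem mem_holderSubmodule_iff {Y : Subshift S ℕ} {lam α : ℝ} (h0 : 0 < lam) (h1 : lam < 1)
    (hα : 0 ≤ α) (A : Y.carrier → ℝ) :
    A ∈ holderSubmodule Y lam α ↔
      ∃ C : ℝ, ∀ x y, |A x - A y| ≤ C * symDist lam x y ^ α := by
  refine ⟨fun h => h.2, fun h => ⟨?_, h⟩⟩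
  obtain ⟨C, hC⟩ := h
  rcases isEmpty_or_nonempty Y.carrier with he | ⟨⟨y⟩⟩
  · exact ⟨0, fun x => he.elim x⟩
  · refine ⟨|C| + |A y|, fun x => ?_⟩
    have hd : symDist lam x y ^ α ≤ 1 :=
      Real.rpow_le_one (symDist_nonneg h0 x y) (symDist_le_one h0 h1 x y) hα
    have hd0 : 0 ≤ symDist lam x y ^ α := Real.rpow_nonneg (symDist_nonneg h0 x y) _
    have h2 : C * symDist lam x y ^ α ≤ |C| := by
      calc C * symDist lam x y ^ α ≤ |C| * symDist lam x y ^ α :=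
            mul_le_mul_of_nonneg_right (le_abs_self C) hd0
        _ ≤ |C| := mul_le_of_le_one_right (abs_nonneg C) hd
    have h3 : |A x| ≤ |A x - A y| + |A y| := by
      simpa using abs_add_le (A x - A y) (A y)
    linarith [hC x y]

/-- The space `C^α` of `α`-Hölder functions, carrying the `α`-Hölder norm defined below (and not
the topology of pointwise convergence). -/
def HolderSpace (Y : Subshift S ℕ) (lam α : ℝ) : Type _ := holderSubmodule Y lam α

instance (Y : Subshift S ℕ) (lam α : ℝ) : AddCommGroup (HolderSpace Y lam α) :=
  inferInstanceAs (AddCommGroup (holderSubmodule Y lam α))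

instance (Y : Subshift S ℕ) (lam α : ℝ) : CoeFun (HolderSpace Y lam α) fun _ => Y.carrier → ℝ :=
  ⟨fun A => A.1⟩

/-- The supremum norm. -/
def supNorm {X : Type*} (A : X → ℝ) : ℝ := ⨆ x, |A x|

/-- The Hölder constant `sup {|A x - A y| / d(x, y) ^ α : 0 < d(x, y) ≤ 1}`. -/
def holdConst {Y : Subshift S ℕ} (lam α : ℝ) (A : Y.carrier → ℝ) : ℝ :=
  ⨆ p : {p : Y.carrier × Y.carrier // 0 < symDist lam p.1 p.2 ∧ symDist lam p.1 p.2 ≤ 1},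
    |A p.1.1 - A p.1.2| / symDist lam p.1.1 p.1.2 ^ α

theorem bddAbove_abs {Y : Subshift S ℕ} {lam α : ℝ} (A : HolderSpace Y lam α) :
    BddAbove (Set.range fun x => |A x|) := by
  obtain ⟨M, hM⟩ := A.2.1
  exact ⟨M, by rintro _ ⟨x, rfl⟩; exact hM x⟩

theorem bddAbove_hold {Y : Subshift S ℕ} {lam α : ℝ} (A : HolderSpace Y lam α) :
    BddAbove (Set.range fun p : {p : Y.carrier × Y.carrier //
      0 < symDist lam p.1 p.2 ∧ symDist lam p.1 p.2 ≤ 1} =>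
        |A p.1.1 - A p.1.2| / symDist lam p.1.1 p.1.2 ^ α) := by
  obtain ⟨C, hC⟩ := A.2.2
  refine ⟨C, ?_⟩
  rintro _ ⟨p, rfl⟩
  exact (div_le_iff₀ (Real.rpow_pos_of_pos p.2.1 α)).2 (hC _ _)

theorem supNorm_nonneg {X : Type*} (A : X → ℝ) : 0 ≤ supNorm A :=
  Real.iSup_nonneg fun _ => abs_nonneg _

theorem holdConst_nonneg {Y : Subshift S ℕ} (lam α : ℝ) (A : Y.carrier → ℝ) :
    0 ≤ holdConst lam α A :=
  Real.iSup_nonneg fun p => div_nonneg (abs_nonneg _) (Real.rpow_nonneg p.2.1.le _)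

/-- The `α`-Hölder norm `‖A‖_α = Hold_α(A) + ‖A‖_0`, as a norm on `C^α`. -/
def holderNorm (Y : Subshift S ℕ) (lam α : ℝ) : AddGroupNorm (HolderSpace Y lam α) where
  toFun A := holdConst lam α A + supNorm A
  map_zero' := by
    have h : ((0 : HolderSpace Y lam α) : Y.carrier → ℝ) = 0 := rfl
    simp [holdConst, supNorm, h]
  add_le' A B := by
    have h : ((A + B : HolderSpace Y lam α) : Y.carrier → ℝ) = fun x => A x + B x := rfl
    have hs : supNorm (A + B : HolderSpace Y lam α) ≤ supNorm A + supNorm B := by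
      refine Real.iSup_le (fun x => ?_) (add_nonneg (supNorm_nonneg _) (supNorm_nonneg _))
      rw [h]
      exact (abs_add_le _ _).trans
        (add_le_add (le_ciSup (bddAbove_abs A) x) (le_ciSup (bddAbove_abs B) x))
    have hh : holdConst lam α (A + B : HolderSpace Y lam α) ≤
        holdConst lam α A + holdConst lam α B := by
      refine Real.iSup_le (fun p => ?_)
        (add_nonneg (holdConst_nonneg _ _ _) (holdConst_nonneg _ _ _))
      refine le_trans ?_
        (add_le_add (le_ciSup (bddAbove_hold A) p) (le_ciSup (bddAbove_hold B) p))
      rw [h, ← add_div]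
      refine div_le_div_of_nonneg_right ?_ (Real.rpow_nonneg p.2.1.le _)
      calc |(A p.1.1 + B p.1.1) - (A p.1.2 + B p.1.2)|
          = |(A p.1.1 - A p.1.2) + (B p.1.1 - B p.1.2)| := by congr 1; ring
        _ ≤ _ := abs_add_le _ _
    linarith
  neg' A := by
    have h : ((-A : HolderSpace Y lam α) : Y.carrier → ℝ) = fun x => -A x := rfl
    have hh : holdConst lam α (-A : HolderSpace Y lam α) = holdConst lam α A := by
      unfold holdConst
      refine iSup_congr fun p => ?_
      rw [h]
      congr 1
      rw [← abs_neg]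
      congr 1
      ring
    have hs : supNorm (-A : HolderSpace Y lam α) = supNorm A := by
      simp [supNorm, h]
    rw [hh, hs]
  eq_zero_of_map_eq_zero' A hA := by
    have h1 := supNorm_nonneg (A : Y.carrier → ℝ)
    have h2 := holdConst_nonneg lam α (A : Y.carrier → ℝ)
    have h3 : supNorm (A : Y.carrier → ℝ) = 0 := by linarith
    refine Subtype.ext (funext fun x => ?_)
    have h4 : |A x| ≤ supNorm (A : Y.carrier → ℝ) := le_ciSup (bddAbove_abs A) x
    exact abs_eq_zero.1 (le_antisymm (h4.trans h3.le) (abs_nonneg _))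

instance (Y : Subshift S ℕ) (lam α : ℝ) : NormedAddCommGroup (HolderSpace Y lam α) :=
  (holderNorm Y lam α).toNormedAddCommGroup

/-! ### Topological pressure -/

/-- A finite set `E` is `(n, ε)`-separated if any two distinct points of `E` have
`max_{0 ≤ i < n} d(σ^i x, σ^i y) > ε`. -/
def IsSeparated {Y : Subshift S ℕ} (lam : ℝ) (n : ℕ) (ε : ℝ) (E : Finset Y.carrier) : Prop :=
  ∀ x ∈ E, ∀ y ∈ E, x ≠ y → ∃ i < n, ε < symDist lam ((sigma Y)^[i] x) ((sigma Y)^[i] y)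

/-- `sup_E ∑_{x ∈ E} exp (A(x) + A(σ x) + ⋯ + A(σ^{n-1} x))`, over all `(n, ε)`-separated sets. -/
def partitionSup {Y : Subshift S ℕ} (lam : ℝ) (A : Y.carrier → ℝ) (n : ℕ) (ε : ℝ) : ENNReal :=
  ⨆ (E : Finset Y.carrier) (_ : IsSeparated lam n ε E),
    ∑ x ∈ E, ENNReal.ofReal (Real.exp (birkhoffSum (sigma Y) A n x))

/-- The topological pressure
`P(A) = lim_{ε → 0} limsup_{n → ∞} (1/n) log sup_E ∑_{x ∈ E} exp (∑_{i < n} A(σ^i x))`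
(`E` runs over the `(n, ε)`-separated sets), in `[-∞, ∞]`. The limit in `ε` is a supremum by
monotonicity. -/
def pressure {Y : Subshift S ℕ} (lam : ℝ) (A : Y.carrier → ℝ) : EReal :=
  ⨆ (ε : ℝ) (_ : 0 < ε),
    limsup (fun n : ℕ => ENNReal.log (partitionSup lam A n ε) / (n : EReal)) atTop

/-- The closure, in the `α`-Hölder topology, of the set of functions which have zero topological
pressure and which are `γ`-Hölder for some `γ > α`. -/
def holderPlusZero (Y : Subshift S ℕ) (lam α : ℝ) : Set (HolderSpace Y lam α) :=
  closure {A | ∃ γ > α, (A : Y.carrier → ℝ) ∈ holderSubmodule Y lam γ ∧ pressure lam A = 0}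

/-! ### Maximizing measures -/

variable [MeasurableSpace S]

/-- `μ` is a shift-invariant Borel probability measure. -/
def IsInvariantProb {Y : Subshift S ℕ} (μ : Measure Y.carrier) : Prop :=
  IsProbabilityMeasure μ ∧ MeasurePreserving (sigma Y) μ μ

/-- `μ` is a maximizing measure for `A`. -/
def IsMaximizing {Y : Subshift S ℕ} (A : Y.carrier → ℝ) (μ : Measure Y.carrier) : Prop :=
  IsInvariantProb μ ∧ ∀ ν : Measure Y.carrier, IsInvariantProb ν → ∫ x, A x ∂ν ≤ ∫ x, A x ∂μ

/-- For a point `p` with `σ^N p = p`, `N ≥ 1`, the measure `(1/N) ∑_{k < N} δ_{σ^k p}`. -/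
def orbitMeasure {Y : Subshift S ℕ} (p : Y.carrier) (N : ℕ) : Measure Y.carrier :=
  (N : ENNReal)⁻¹ • ∑ k ∈ Finset.range N, Measure.dirac ((sigma Y)^[k] p)

/-- The set of `A` in `holderPlusZero` such that, for some periodic point `p` and some
neighbourhood `U` of `A` in `holderPlusZero`, the measure on the orbit of `p` is the unique
maximizing measure of every `B ∈ U`. -/
def periodicLocked (Y : Subshift S ℕ) (lam α : ℝ) : Set (holderPlusZero Y lam α) :=
  {A | ∃ (p : Y.carrier) (N : ℕ), 0 < N ∧ (sigma Y)^[N] p = p ∧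
    ∃ U ∈ 𝓝 A, ∀ B ∈ U, ∀ μ : Measure Y.carrier,
      IsMaximizing (B.1 : Y.carrier → ℝ) μ ↔ μ = orbitMeasure p N}

end HolderShift

end

/-!
A function that is `γ`-Hölder for some `γ > α` is close, in the `α`-Hölder norm, to a function `B`
of finitely many letters. Such a `B` lives on the edges of the finite graph of words of some length
`k`. Among the cycles of this graph on which `B` has maximal mean `β`, take one of minimal length.
The Birkhoff sums of `B` over `n` steps exceed `n β` by a bounded amount only, as one sees by
cutting cycles out of a path. By minimality that cycle visits no word twice, so a point that always
stays on its edges lies on the periodic orbit. Subtracting `ε` times the indicator function of the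
points off the cycle therefore makes the periodic orbit uniquely maximizing. This survives the
addition of a function `g` with small Hölder constant: by bounded distortion, the Birkhoff sums of
`g` deviate from their mean over the cycle by at most a small multiple of the number of visits off
the cycle, plus a constant. Finally, subtracting a small constant brings the pressure back to `0`
and does not change the maximizing measures.
-/

noncomputable section

namespace HolderShift

open Function (IsPeriodicPt)

/-! ### Birkhoff sums -/

section Birkhoff

variable {X : Type*} {T : X → X}

theorem abs_birkhoffSum_le (T : X → X) {g : X → ℝ} {M : ℝ} (hM : ∀ x, |g x| ≤ M) (n : ℕ) (x : X) :
    |birkhoffSum T g n x| ≤ n * M := by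
  refine (Finset.abs_sum_le_sum_abs _ _).trans ?_
  simpa using Finset.sum_le_card_nsmul (Finset.range n) _ M fun i _ => hM (T^[i] x)

theorem birkhoffSum_sub_const (T : X → X) (g : X → ℝ) (c : ℝ) (n : ℕ) (x : X) :
    birkhoffSum T (fun y => g y - c) n x = birkhoffSum T g n x - n * c := by
  simp [birkhoffSum]

theorem birkhoffSum_const_smul (T : X → X) (c : ℝ) (g : X → ℝ) (n : ℕ) (x : X) :
    birkhoffSum T (c • g) n x = c * birkhoffSum T g n x := by
  simp [birkhoffSum, Finset.mul_sum]

theorem birkhoffSum_apply_of_isPeriodicPt {M : Type*} [AddCommMonoid M] {N : ℕ} {p : X}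
    (hp : IsPeriodicPt T N p) (g : X → M) : birkhoffSum T g N (T p) = birkhoffSum T g N p := by
  cases N with
  | zero => rfl
  | succ n =>
    rw [birkhoffSum_succ, birkhoffSum_succ', ← Function.iterate_succ_apply, hp.eq, add_comm]

theorem birkhoffSum_iterate_of_isPeriodicPt {M : Type*} [AddCommMonoid M] {N : ℕ} {p : X}
    (hp : IsPeriodicPt T N p) (g : X → M) (i : ℕ) :
    birkhoffSum T g N (T^[i] p) = birkhoffSum T g N p := by
  induction i with
  | zero => rfl
  | succ i ih =>
    rw [Function.iterate_succ_apply', birkhoffSum_apply_of_isPeriodicPt (hp.apply_iterate i), ih]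

theorem abs_birkhoffSum_le_of_isPeriodicPt {g : X → ℝ} {M : ℝ} (hM : ∀ x, |g x| ≤ M) {N : ℕ}
    (hN : 0 < N) {p : X} (hp : IsPeriodicPt T N p) (hg : birkhoffSum T g N p = 0) (n : ℕ) :
    |birkhoffSum T g n p| ≤ N * M := by
  induction n using Nat.strong_induction_on with
  | _ n ih =>
    rcases lt_or_ge n N with hn | hn
    · have hM0 : 0 ≤ M := (abs_nonneg _).trans (hM p)
      exact (abs_birkhoffSum_le T hM n p).trans (by gcongr)
    · obtain ⟨r, rfl⟩ := Nat.exists_eq_add_of_le hn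
      rw [birkhoffSum_add, hg, hp.eq, zero_add]
      exact ih r (by omega)

/-- Cut the orbit at its visits to `sᶜ`: each of the pieces in between contributes at most `D`, and
each visit at most `M`. -/
theorem birkhoffSum_le_of_forall_mem {g : X → ℝ} {s : Set X} {D M : ℝ} (hM : ∀ x, g x ≤ M)
    (hD : ∀ n x, (∀ t < n, T^[t] x ∈ s) → birkhoffSum T g n x ≤ D) (n : ℕ) (x : X) :
    birkhoffSum T g n x ≤ D + (D + M) * birkhoffSum T (sᶜ.indicator 1) n x := by
  suffices h : ∀ n L x, (∀ t < L, T^[t] x ∈ s) → birkhoffSum T g (L + n) x ≤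
      D + (D + M) * birkhoffSum T (sᶜ.indicator 1) n (T^[L] x) by
    simpa using h n 0 x
  intro n
  induction n with
  | zero => simpa using hD
  | succ n ih =>
    intro L x hL
    by_cases hx : T^[L] x ∈ s
    · have hL' : ∀ t < L + 1, T^[t] x ∈ s := fun t ht =>
        (Nat.lt_succ_iff_lt_or_eq.1 ht).elim (hL t) fun h => h ▸ hx
      have hsum := ih (L + 1) x hL'
      rw [Function.iterate_succ_apply'] at hsum
      rw [birkhoffSum_succ', Set.indicator_of_notMem (Set.notMem_compl_iff.2 hx), zero_add,
        ← add_assoc, add_right_comm]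
      exact hsum
    · have htail := ih 0 (T (T^[L] x)) (by simp)
      rw [zero_add, Function.iterate_zero_apply] at htail
      rw [birkhoffSum_add, birkhoffSum_succ', birkhoffSum_succ',
        Set.indicator_of_mem (Set.mem_compl hx), Pi.one_apply]
      linarith [hD L x hL, hM (T^[L] x)]

theorem natCast_mul_birkhoffAverage (T : X → X) (g : X → ℝ) {n : ℕ} (hn : n ≠ 0) (x : X) :
    n * birkhoffAverage ℝ T g n x = birkhoffSum T g n x :=
  mul_inv_cancel_left₀ (Nat.cast_ne_zero.2 hn) _

theorem abs_sub_birkhoffAverage_le (T : X → X) {g : X → ℝ} {C : ℝ}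
    (hg : ∀ x y, |g x - g y| ≤ C) {n : ℕ} (hn : 0 < n) (x y : X) :
    |g x - birkhoffAverage ℝ T g n y| ≤ C := by
  have hsum := abs_birkhoffSum_le T (g := fun z => g z - g x) (fun z => hg z x) n y
  rw [birkhoffSum_sub_const, ← natCast_mul_birkhoffAverage T g hn.ne', ← mul_sub, abs_mul,
    Nat.abs_cast] at hsum
  rw [abs_sub_comm]
  exact le_of_mul_le_mul_left hsum (Nat.cast_pos.2 hn)

section Integral

variable [MeasurableSpace X] {μ : Measure X} {g : X → ℝ}

theorem integrable_birkhoffSum (hT : MeasurePreserving T μ μ) (hg : Integrable g μ) (n : ℕ) :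
    Integrable (birkhoffSum T g n) μ :=
  integrable_finsetSum _ fun i _ => (hT.iterate i).integrable_comp_of_integrable hg

theorem integral_birkhoffSum (hT : MeasurePreserving T μ μ) (hg : Integrable g μ) (n : ℕ) :
    ∫ x, birkhoffSum T g n x ∂μ = n * ∫ x, g x ∂μ := by
  have hcomp : ∀ i, ∫ x, g (T^[i] x) ∂μ = ∫ x, g x ∂μ := fun i => by
    have hmap := (hT.iterate i).map_eq
    rw [← integral_map (hT.iterate i).aemeasurable (hmap.symm ▸ hg.aestronglyMeasurable), hmap]
  have hint : ∀ i ∈ Finset.range n, Integrable (fun x => g (T^[i] x)) μ := fun i _ =>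
    (hT.iterate i).integrable_comp_of_integrable hg
  unfold birkhoffSum
  rw [integral_finsetSum _ hint]
  simp only [hcomp, Finset.sum_const, Finset.card_range, nsmul_eq_mul]

theorem integral_le_of_birkhoffSum_le [IsProbabilityMeasure μ] (hT : MeasurePreserving T μ μ)
    (hg : Integrable g μ) {β K : ℝ} (h : ∀ n x, birkhoffSum T g n x ≤ n * β + K) :
    ∫ x, g x ∂μ ≤ β := by
  have hbound : ∀ n : ℕ, n * (∫ x, g x ∂μ - β) ≤ K := fun n => by
    have hint := integral_mono (integrable_birkhoffSum hT hg n) (integrable_const _) (h n)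
    rw [integral_birkhoffSum hT hg, integral_const, probReal_univ, one_smul] at hint
    linarith
  by_contra! hlt
  obtain ⟨n, hn⟩ := exists_nat_gt (K / (∫ x, g x ∂μ - β))
  exact (hbound n).not_gt ((div_lt_iff₀ (sub_pos.2 hlt)).1 hn)

end Integral

end Birkhoff

variable {S : Type*} [TopologicalSpace S] {Y : Subshift S ℕ}

/-! ### Words -/

theorem sigma_iterate_apply (n : ℕ) (x : Y.carrier) (i : ℕ) :
    ((sigma Y)^[n] x).1 i = x.1 (n + i) := by
  induction n generalizing x i with
  | zero => simp
  | succ n ih =>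
    rw [Function.iterate_succ_apply, ih]
    exact congrArg x.1 (by omega : 1 + (n + i) = n + 1 + i)

/-- The word formed by the first `n` letters of `x`. -/
def word (n : ℕ) (x : Y.carrier) : Fin n → S := fun i => x.1 i

/-- `x` and `y` have the same first `n` letters, i.e. they lie in the same cylinder of length
`n`. -/
def Agree (n : ℕ) (x y : Y.carrier) : Prop := ∀ i < n, x.1 i = y.1 i

theorem word_eq_word_iff {n : ℕ} {x y : Y.carrier} : word n x = word n y ↔ Agree n x y :=
  ⟨fun h i hi => congrFun h ⟨i, hi⟩, fun h => funext fun i => h i i.2⟩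

namespace Agree

variable {m n : ℕ} {x y z : Y.carrier}

theorem refl (n : ℕ) (x : Y.carrier) : Agree n x x := fun _ _ => rfl

theorem symm (h : Agree n x y) : Agree n y x := fun i hi => (h i hi).symm

theorem trans (h : Agree n x y) (h' : Agree n y z) : Agree n x z :=
  fun i hi => (h i hi).trans (h' i hi)

theorem mono (hmn : m ≤ n) (h : Agree n x y) : Agree m x y := fun i hi => h i (hi.trans_le hmn)

theorem iterate (h : Agree (m + n) x y) : Agree n ((sigma Y)^[m] x) ((sigma Y)^[m] y) :=
  fun i hi => by
    rw [sigma_iterate_apply, sigma_iterate_apply]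
    exact h _ (by omega)

theorem append (h : Agree m x y) (h' : Agree n ((sigma Y)^[m] x) ((sigma Y)^[m] y)) :
    Agree (m + n) x y := fun i hi => by
  rcases lt_or_ge i m with him | him
  · exact h i him
  · obtain ⟨j, rfl⟩ := Nat.exists_eq_add_of_le him
    simpa only [sigma_iterate_apply] using h' j (by omega)

end Agree

theorem eq_of_forall_agree {x y : Y.carrier} (h : ∀ n, Agree n x y) : x = y :=
  Subtype.ext (funext fun i => h (i + 1) i i.lt_succ_self)

theorem isOpen_setOf_agree [DiscreteTopology S] (n : ℕ) (x : Y.carrier) :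
    IsOpen {y : Y.carrier | Agree n y x} :=
  (PiNat.isOpen_cylinder (fun _ => S) x.1 n).preimage continuous_subtype_val

theorem exists_agree_iterate [Finite S] (k : ℕ) (x : Y.carrier) :
    ∃ i d, 0 < d ∧ i + d ≤ Nat.card (Fin k → S) ∧
      Agree k ((sigma Y)^[i] x) ((sigma Y)^[i + d] x) := by
  have := Fintype.ofFinite (Fin k → S)
  obtain ⟨a, b, hab, h⟩ := Fintype.exists_ne_map_eq_of_card_lt
    (fun i : Fin (Nat.card (Fin k → S) + 1) => word k ((sigma Y)^[i] x))
    (by simp [Nat.card_eq_fintype_card])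
  wlog hlt : a < b generalizing a b
  · exact this b a hab.symm h.symm (lt_of_le_of_ne (not_lt.1 hlt) hab.symm)
  obtain ⟨d, hd⟩ := Nat.exists_eq_add_of_lt hlt
  exact ⟨a, d + 1, by omega, by omega, by rw [← add_assoc, ← hd]; exact word_eq_word_iff.1 h⟩

theorem finite_ptsOfPeriod_sigma [Finite S] {N : ℕ} (hN : 0 < N) :
    (Function.ptsOfPeriod (sigma Y) N).Finite := by
  refine Set.Finite.of_injOn (f := word N) (Set.mapsTo_univ _ _) (fun p hp q hq h => ?_)
    Set.finite_univ
  have hmod : ∀ r : Y.carrier, IsPeriodicPt (sigma Y) N r → ∀ u, r.1 u = r.1 (u % N) := by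
    intro r hr u
    conv_rhs => rw [← hr.mul_const (u / N), sigma_iterate_apply, Nat.div_add_mod]
  refine Subtype.ext (funext fun u => ?_)
  rw [hmod p hp, hmod q hq]
  exact word_eq_word_iff.1 h _ (Nat.mod_lt u hN)

/-! ### Gluing orbits of a subshift of finite type -/

/-- `Y` is the set of all sequences whose words of length `k + 1` occur as initial words of points
of `Y`; equivalently, `Y` is a topological Markov chain on its words of length `k`. -/
def HasMemory (Y : Subshift S ℕ) (k : ℕ) : Prop :=
  ∀ z : ℕ → S, (∀ t, ∃ y : Y.carrier, ∀ s ≤ k, z (t + s) = y.1 s) → z ∈ Y.carrier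

theorem IsFiniteType.eventually_hasMemory [Inhabited S] (hY : IsFiniteType Y) :
    ∀ᶠ k in atTop, HasMemory Y k := by
  obtain ⟨F, hF, hYF⟩ := hY
  obtain ⟨k₀, hk₀⟩ : ∃ k₀ : ℕ, ∀ P ∈ F, ∀ s ∈ P.support, s ≤ k₀ :=
    ⟨hF.toFinset.sup fun P => P.support.sup id, fun P hP s hs =>
      (Finset.le_sup (f := id) hs).trans
        (Finset.le_sup (f := fun P : Pattern S ℕ => P.support.sup id) (hF.mem_toFinset.2 hP))⟩
  filter_upwards [eventually_ge_atTop k₀] with k hk z hz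
  rw [hYF]
  intro P hP t hocc
  obtain ⟨y, hy⟩ := hz t
  have hyF : y.1 ∈ forbidden F := hYF ▸ y.2
  refine hyF P hP 0 fun s hs => ?_
  rw [zero_add, ← hy s ((hk₀ P hP s hs).trans hk)]
  exact hocc s hs

namespace HasMemory

variable {k : ℕ}

theorem exists_glue (hk : HasMemory Y k) {x y : Y.carrier} {i : ℕ}
    (h : Agree k ((sigma Y)^[i] x) y) :
    ∃ z : Y.carrier, Agree (i + k) z x ∧ (sigma Y)^[i] z = y := by
  let z : ℕ → S := fun u => if u < i then x.1 u else y.1 (u - i)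
  have hzy : ∀ u, z (i + u) = y.1 u := fun u => by simp [z]
  have hzx : ∀ u < i + k, z u = x.1 u := fun u hu => by
    rcases lt_or_ge u i with hui | hui
    · exact if_pos hui
    · obtain ⟨v, rfl⟩ := Nat.exists_eq_add_of_le hui
      rw [hzy, ← h v (by omega), sigma_iterate_apply]
  have hz : z ∈ Y.carrier := by
    refine hk z fun t => ?_
    rcases lt_or_ge t i with hti | hti
    · exact ⟨(sigma Y)^[t] x, fun s hs => by rw [sigma_iterate_apply, hzx _ (by omega)]⟩
    · obtain ⟨v, rfl⟩ := Nat.exists_eq_add_of_le hti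
      exact ⟨(sigma Y)^[v] y, fun s _ => by rw [sigma_iterate_apply, add_assoc, hzy]⟩
  refine ⟨⟨z, hz⟩, hzx, Subtype.ext (funext fun u => ?_)⟩
  rw [sigma_iterate_apply]
  exact hzy u

theorem exists_isPeriodicPt (hk : HasMemory Y k) {x : Y.carrier} {N : ℕ} (hN : 0 < N)
    (h : Agree k x ((sigma Y)^[N] x)) :
    ∃ p : Y.carrier, IsPeriodicPt (sigma Y) N p ∧ Agree (N + k) p x := by
  have hper : ∀ u < N + k, x.1 (u % N) = x.1 u := by
    intro u
    induction u using Nat.strong_induction_on with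
    | _ u ih =>
      intro hu
      rcases lt_or_ge u N with hlt | hge
      · rw [Nat.mod_eq_of_lt hlt]
      · obtain ⟨v, rfl⟩ := Nat.exists_eq_add_of_le hge
        rw [Nat.add_mod_left, ih v (by omega) (by omega), h v (by omega), sigma_iterate_apply]
  have hmem : (fun u => x.1 (u % N)) ∈ Y.carrier := by
    refine hk _ fun t => ⟨(sigma Y)^[t % N] x, fun s hs => ?_⟩
    have ht := Nat.mod_lt t hN
    rw [sigma_iterate_apply, ← hper (t % N + s) (by omega), Nat.mod_add_mod]
  refine ⟨⟨_, hmem⟩, Subtype.ext (funext fun u => ?_), hper⟩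
  rw [sigma_iterate_apply]
  exact congrArg x.1 (Nat.add_mod_left N u)

end HasMemory

/-! ### Functions of finitely many letters -/

/-- `A x` depends on the first `n` letters of `x` only. -/
def IsLocal (n : ℕ) (A : Y.carrier → ℝ) : Prop := ∀ ⦃x y⦄, Agree n x y → A x = A y

namespace IsLocal

variable {n : ℕ} {A B : Y.carrier → ℝ}

theorem sub (hA : IsLocal n A) (hB : IsLocal n B) : IsLocal n (A - B) := fun _ _ h =>
  congrArg₂ (· - ·) (hA h) (hB h)

theorem const_smul (hA : IsLocal n A) (c : ℝ) : IsLocal n (c • A) := fun _ _ h =>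
  congrArg (c * ·) (hA h)

theorem sub_const (hA : IsLocal n A) (c : ℝ) : IsLocal n (fun x => A x - c) := fun _ _ h =>
  congrArg (· - c) (hA h)

theorem birkhoffSum_eq {k : ℕ} (hA : IsLocal (k + 1) A) {n : ℕ} {x y : Y.carrier}
    (h : Agree (n + k) x y) : birkhoffSum (sigma Y) A n x = birkhoffSum (sigma Y) A n y :=
  Finset.sum_congr rfl fun i hi => hA (h.mono (by have := Finset.mem_range.1 hi; omega)).iterate

theorem exists_abs_le [Finite S] (hA : IsLocal n A) : ∃ M, ∀ x, |A x| ≤ M := by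
  have hfactor : Function.FactorsThrough (fun x => |A x|) (word n) := fun _ _ hxy =>
    congrArg abs (hA (word_eq_word_iff.1 hxy))
  have hfinite : (Set.range fun x => |A x|).Finite := by
    rw [← hfactor.extend_comp fun _ => 0]
    exact (Set.finite_range _).subset (Set.range_comp_subset_range _ _)
  obtain ⟨M, hM⟩ := hfinite.bddAbove
  exact ⟨M, fun x => hM ⟨x, rfl⟩⟩

theorem continuous [DiscreteTopology S] (hA : IsLocal n A) : Continuous A :=
  IsLocallyConstant.continuous <| (IsLocallyConstant.iff_eventually_eq A).2 fun x =>
    mem_of_superset ((isOpen_setOf_agree n x).mem_nhds (Agree.refl n x)) fun _ hy => hA hy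

end IsLocal

/-! ### Cycles of maximal mean -/

/-- The orbit of `p` is determined by its words of length `k`: as a closed walk on the graph of
words of length `k`, it does not visit a vertex twice. -/
def OrbitSeparated (k : ℕ) (p : Y.carrier) : Prop :=
  ∀ ⦃i j⦄, Agree k ((sigma Y)^[i] p) ((sigma Y)^[j] p) → (sigma Y)^[i] p = (sigma Y)^[j] p

theorem finite_setOf_isPeriodicPt_le [Finite S] (W : ℕ) :
    {c : Y.carrier × ℕ | IsPeriodicPt (sigma Y) c.2 c.1 ∧ 0 < c.2 ∧ c.2 ≤ W}.Finite := by
  refine ((Set.finite_Ioc 0 W).biUnion fun n hn =>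
    (finite_ptsOfPeriod_sigma hn.1).image fun p : Y.carrier => (p, n)).subset ?_
  rintro ⟨p, n⟩ ⟨hp, hn⟩
  exact Set.mem_biUnion hn ⟨p, hp, rfl⟩

namespace HasMemory

variable {k N : ℕ} {A : Y.carrier → ℝ} {p : Y.carrier}

theorem exists_birkhoffSum_le [Finite S] (hk : HasMemory Y k) (hA : IsLocal (k + 1) A)
    (hcycle : ∀ q n, IsPeriodicPt (sigma Y) n q → 0 < n → n ≤ Nat.card (Fin k → S) →
      birkhoffSum (sigma Y) A n q ≤ 0) :
    ∃ K, ∀ n x, birkhoffSum (sigma Y) A n x ≤ K := by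
  obtain ⟨M, hM⟩ := hA.exists_abs_le
  refine ⟨Nat.card (Fin k → S) * M, fun n => ?_⟩
  induction n using Nat.strong_induction_on with
  | _ n ih =>
    intro x
    rcases lt_or_ge n (Nat.card (Fin k → S)) with hn | hn
    · have hM0 : 0 ≤ M := (abs_nonneg _).trans (hM x)
      exact (le_abs_self _).trans ((abs_birkhoffSum_le _ hM n x).trans (by gcongr))
    obtain ⟨i, d, hd, hid, hagree⟩ := exists_agree_iterate k x
    obtain ⟨r, rfl⟩ := Nat.exists_eq_add_of_le (hid.trans hn)
    have hloop : birkhoffSum (sigma Y) A d ((sigma Y)^[i] x) ≤ 0 := by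
      obtain ⟨q, hq, hqx⟩ := hk.exists_isPeriodicPt hd
        (by rwa [← Function.iterate_add_apply, add_comm d])
      exact (hA.birkhoffSum_eq hqx).symm.trans_le (hcycle q d hq hd (by omega))
    obtain ⟨z, hzx, hz⟩ := hk.exists_glue hagree
    have hcut : birkhoffSum (sigma Y) A (i + r) z = birkhoffSum (sigma Y) A i x +
        birkhoffSum (sigma Y) A r ((sigma Y)^[i + d] x) := by
      rw [birkhoffSum_add, hz, hA.birkhoffSum_eq hzx]
    rw [birkhoffSum_add, birkhoffSum_add]
    linarith [ih (i + r) (by omega) z]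

theorem not_agree_iterate (hk : HasMemory Y k) (hA : IsLocal (k + 1) A)
    (hp : IsPeriodicPt (sigma Y) N p) (hsum : birkhoffSum (sigma Y) A N p = 0)
    (hneg : ∀ q n, IsPeriodicPt (sigma Y) n q → 0 < n → n < N → birkhoffSum (sigma Y) A n q < 0)
    {d : ℕ} (hd : 0 < d) (hdN : d < N) : ¬ Agree k p ((sigma Y)^[d] p) := fun h => by
  have hloop : ∀ {x e}, 0 < e → e < N → Agree k x ((sigma Y)^[e] x) →
      birkhoffSum (sigma Y) A e x < 0 := fun he heN hx => by
    obtain ⟨q, hq, hqx⟩ := hk.exists_isPeriodicPt he hx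
    exact (hA.birkhoffSum_eq hqx).symm.trans_lt (hneg q _ hq he heN)
  have hreturn : (sigma Y)^[N - d] ((sigma Y)^[d] p) = p := by
    rw [← Function.iterate_add_apply, Nat.sub_add_cancel hdN.le, hp.eq]
  have hsplit := birkhoffSum_add (sigma Y) A d (N - d) p
  rw [Nat.add_sub_cancel' hdN.le, hsum] at hsplit
  linarith [hloop hd hdN h, hloop (x := (sigma Y)^[d] p) (Nat.sub_pos_of_lt hdN)
    (Nat.sub_lt (hd.trans hdN) hd) (hreturn.symm ▸ h.symm)]

theorem orbitSeparated (hk : HasMemory Y k) (hA : IsLocal (k + 1) A) (hN : 0 < N)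
    (hp : IsPeriodicPt (sigma Y) N p) (hsum : birkhoffSum (sigma Y) A N p = 0)
    (hneg : ∀ q n, IsPeriodicPt (sigma Y) n q → 0 < n → n < N → birkhoffSum (sigma Y) A n q < 0) :
    OrbitSeparated k p := by
  intro i j h
  wlog hij : i ≤ j generalizing i j
  · exact (this h.symm (le_of_not_ge hij)).symm
  obtain ⟨e, rfl⟩ := Nat.exists_eq_add_of_le' hij
  have hpi := hp.apply_iterate i
  rw [Function.iterate_add_apply, ← hpi.iterate_mod_apply] at h ⊢
  rcases (e % N).eq_zero_or_pos with he | he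
  · rw [he, Function.iterate_zero_apply]
  · exact absurd h (hk.not_agree_iterate hA hpi
      ((birkhoffSum_iterate_of_isPeriodicPt hp A i).trans hsum) hneg he (Nat.mod_lt e hN))

theorem exists_cycle [Finite S] [Nonempty Y.carrier] (hk : HasMemory Y k) :
    ∃ (p : Y.carrier) (N : ℕ), IsPeriodicPt (sigma Y) N p ∧ 0 < N ∧ N ≤ Nat.card (Fin k → S) := by
  obtain ⟨i, d, hd, hid, h⟩ := exists_agree_iterate k (Classical.arbitrary Y.carrier)
  rw [add_comm i, Function.iterate_add_apply] at h
  obtain ⟨p, hp, -⟩ := hk.exists_isPeriodicPt hd h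
  exact ⟨p, d, hp, hd, by omega⟩

theorem exists_maximal_cycle [Finite S] [Nonempty Y.carrier] (hk : HasMemory Y k)
    (A : Y.carrier → ℝ) :
    ∃ (p : Y.carrier) (N : ℕ), IsPeriodicPt (sigma Y) N p ∧ 0 < N ∧ N ≤ Nat.card (Fin k → S) ∧
      ∀ q n, IsPeriodicPt (sigma Y) n q → 0 < n → n ≤ Nat.card (Fin k → S) →
        birkhoffAverage ℝ (sigma Y) A n q ≤ birkhoffAverage ℝ (sigma Y) A N p ∧
        (n < N → birkhoffAverage ℝ (sigma Y) A n q < birkhoffAverage ℝ (sigma Y) A N p) := by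
  -- maximize the mean first, then minimize the length
  let rank : Y.carrier × ℕ → ℝ ×ₗ ℕᵒᵈ := fun c =>
    toLex (birkhoffAverage ℝ (sigma Y) A c.2 c.1, OrderDual.toDual c.2)
  obtain ⟨q₀, n₀, h₀⟩ := hk.exists_cycle
  obtain ⟨⟨p, N⟩, ⟨hp, hN, hNW⟩, hmax⟩ := Set.exists_max_image _ rank
    (finite_setOf_isPeriodicPt_le (Nat.card (Fin k → S))) ⟨(q₀, n₀), h₀⟩
  refine ⟨p, N, hp, hN, hNW, fun q n hq hn hnW => ?_⟩
  rcases Prod.Lex.toLex_le_toLex.1 (hmax (q, n) ⟨hq, hn, hnW⟩) with hlt | ⟨heq, hle⟩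
  · exact ⟨hlt.le, fun _ => hlt⟩
  · exact ⟨heq.le, fun hnN => absurd hnN (not_lt.2 (OrderDual.toDual_le_toDual.1 hle))⟩

theorem exists_dominating_cycle [Finite S] [Nonempty Y.carrier] (hk : HasMemory Y k)
    (hA : IsLocal (k + 1) A) :
    ∃ (p : Y.carrier) (N : ℕ), 0 < N ∧ IsPeriodicPt (sigma Y) N p ∧ OrbitSeparated k p ∧
      ∃ K, ∀ n x,
        birkhoffSum (sigma Y) A n x ≤ n * birkhoffAverage ℝ (sigma Y) A N p + K := by
  obtain ⟨p, N, hp, hN, hNW, hmax⟩ := hk.exists_maximal_cycle A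
  set β := birkhoffAverage ℝ (sigma Y) A N p
  have hsum : ∀ q {n}, 0 < n → birkhoffSum (sigma Y) (fun x => A x - β) n q =
      n * (birkhoffAverage ℝ (sigma Y) A n q - β) := fun q n hn => by
    rw [birkhoffSum_sub_const, mul_sub, natCast_mul_birkhoffAverage _ _ hn.ne']
  have hlocal := hA.sub_const β
  refine ⟨p, N, hN, hp, hk.orbitSeparated hlocal hN hp (by rw [hsum p hN, sub_self, mul_zero])
    fun q n hq hn hnN => ?_, ?_⟩
  · rw [hsum q hn]
    exact mul_neg_of_pos_of_neg (Nat.cast_pos.2 hn)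
      (sub_neg.2 ((hmax q n hq hn (hnN.le.trans hNW)).2 hnN))
  · obtain ⟨K, hK⟩ := hk.exists_birkhoffSum_le hlocal fun q n hq hn hnW => by
      rw [hsum q hn]
      exact mul_nonpos_of_nonneg_of_nonpos n.cast_nonneg (sub_nonpos.2 (hmax q n hq hn hnW).1)
    refine ⟨K, fun n x => ?_⟩
    have hKx := hK n x
    rw [birkhoffSum_sub_const] at hKx
    linarith

end HasMemory

/-! ### Hölder functions -/

section Holder

variable {lam α : ℝ} {n : ℕ} {x y : Y.carrier}

theorem symDist_le_pow_iff (h0 : 0 < lam) (h1 : lam < 1) :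
    symDist lam x y ≤ lam ^ n ↔ Agree n x y := by
  unfold symDist
  split_ifs with hxy
  · exact iff_of_true (pow_pos h0 n).le (hxy ▸ Agree.refl n x)
  · rw [pow_le_pow_iff_right_of_lt_one₀ h0 h1,
      ← PiNat.mem_cylinder_iff_le_firstDiff (Subtype.coe_injective.ne hxy)]
    exact Iff.rfl

theorem Agree.symDist_rpow_le (h0 : 0 < lam) (h1 : lam < 1) (hα : 0 ≤ α) (h : Agree n x y) :
    symDist lam x y ^ α ≤ (lam ^ α) ^ n := by
  rw [Real.rpow_pow_comm h0.le]
  exact Real.rpow_le_rpow (symDist_nonneg h0 x y) ((symDist_le_pow_iff h0 h1).2 h) hα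

theorem le_symDist_rpow_of_not_agree (h0 : 0 < lam) (h1 : lam < 1) (hα : 0 ≤ α)
    (h : ¬ Agree n x y) : (lam ^ α) ^ n ≤ symDist lam x y ^ α := by
  rw [Real.rpow_pow_comm h0.le]
  exact Real.rpow_le_rpow (by positivity) (not_le.1 (mt (symDist_le_pow_iff h0 h1).1 h)).le hα

/-- `A` is `α`-Hölder with constant `C`, for the distance `symDist lam`. -/
def IsHolderWith (lam α C : ℝ) (A : Y.carrier → ℝ) : Prop :=
  ∀ x y, |A x - A y| ≤ C * symDist lam x y ^ α

theorem exists_isHolderWith {A : Y.carrier → ℝ} (hA : A ∈ holderSubmodule Y lam α)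
    (h0 : 0 < lam) : ∃ C, 0 ≤ C ∧ IsHolderWith lam α C A := by
  obtain ⟨C, hC⟩ := hA.2
  refine ⟨|C|, abs_nonneg C, fun x y => (hC x y).trans ?_⟩
  have hdist := Real.rpow_nonneg (symDist_nonneg h0 x y) α
  gcongr
  exact le_abs_self C

namespace IsHolderWith

variable {A B : Y.carrier → ℝ} {C C' : ℝ}

theorem sub (hA : IsHolderWith lam α C A) (hB : IsHolderWith lam α C' B) :
    IsHolderWith lam α (C + C') (A - B) := fun x y => by
  simp only [Pi.sub_apply]
  rw [sub_sub_sub_comm, add_mul]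
  exact (abs_sub _ _).trans (add_le_add (hA x y) (hB x y))

theorem mono (h0 : 0 < lam) (hCC' : C ≤ C') (hA : IsHolderWith lam α C A) :
    IsHolderWith lam α C' A := fun x y =>
  (hA x y).trans (mul_le_mul_of_nonneg_right hCC' (Real.rpow_nonneg (symDist_nonneg h0 x y) α))

theorem sub_const (hA : IsHolderWith lam α C A) (c : ℝ) :
    IsHolderWith lam α C (fun x => A x - c) := fun x y => by
  rw [sub_sub_sub_cancel_right]
  exact hA x y

theorem abs_sub_le_of_agree (h0 : 0 < lam) (h1 : lam < 1) (hα : 0 ≤ α) (hC : 0 ≤ C)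
    (hA : IsHolderWith lam α C A) (h : Agree n x y) : |A x - A y| ≤ C * (lam ^ α) ^ n :=
  (hA x y).trans (mul_le_mul_of_nonneg_left (h.symDist_rpow_le h0 h1 hα) hC)

theorem abs_sub_le (h0 : 0 < lam) (h1 : lam < 1) (hα : 0 ≤ α) (hC : 0 ≤ C)
    (hA : IsHolderWith lam α C A) (x y : Y.carrier) : |A x - A y| ≤ C := by
  simpa using hA.abs_sub_le_of_agree h0 h1 hα hC (n := 0) (x := x) (y := y) (by simp [Agree])

theorem continuous [DiscreteTopology S] (h0 : 0 < lam) (h1 : lam < 1) (hα : 0 < α) (hC : 0 ≤ C)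
    (hA : IsHolderWith lam α C A) : Continuous A := by
  refine continuous_iff_continuousAt.2 fun x => Metric.tendsto_nhds.2 fun ε hε => ?_
  have hlim : Tendsto (fun n => C * (lam ^ α) ^ n) atTop (𝓝 0) := by
    simpa using (tendsto_pow_atTop_nhds_zero_of_lt_one (Real.rpow_nonneg h0.le α)
      (Real.rpow_lt_one h0.le h1 hα)).const_mul C
  obtain ⟨n, hn⟩ := (hlim.eventually_lt_const hε).exists
  filter_upwards [(isOpen_setOf_agree n x).mem_nhds (Agree.refl n x)] with y hy
  exact (hA.abs_sub_le_of_agree h0 h1 hα.le hC hy).trans_lt hn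

theorem birkhoffSum_sub_le_of_agree (h0 : 0 < lam) (h1 : lam < 1) (hα : 0 < α) (hC : 0 ≤ C)
    (hA : IsHolderWith lam α C A) (h : Agree n x y) :
    birkhoffSum (sigma Y) A n x - birkhoffSum (sigma Y) A n y ≤ C * (1 - lam ^ α)⁻¹ := by
  have hterm : ∀ i ∈ Finset.range n,
      A ((sigma Y)^[i] x) - A ((sigma Y)^[i] y) ≤ C * (lam ^ α) ^ (n - i) := fun i hi =>
    (le_abs_self _).trans (hA.abs_sub_le_of_agree h0 h1 hα.le hC (Agree.iterate (h.mono
      (Nat.add_sub_cancel' (Finset.mem_range.1 hi).le).le)))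
  have hθ0 := Real.rpow_pos_of_pos h0 α
  have hθ1 := Real.rpow_lt_one h0.le h1 hα
  calc birkhoffSum (sigma Y) A n x - birkhoffSum (sigma Y) A n y
      ≤ ∑ i ∈ Finset.range n, C * (lam ^ α) ^ (n - i) := by
        unfold birkhoffSum
        rw [← Finset.sum_sub_distrib]
        exact Finset.sum_le_sum hterm
    _ ≤ ∑ i ∈ Finset.range n, C * (lam ^ α) ^ (n - 1 - i) := Finset.sum_le_sum fun i _ =>
        mul_le_mul_of_nonneg_left (pow_le_pow_of_le_one hθ0.le hθ1.le (by omega)) hC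
    _ = C * ∑ i ∈ Finset.range n, (lam ^ α) ^ i := by
        rw [Finset.sum_range_reflect fun i => C * (lam ^ α) ^ i, Finset.mul_sum]
    _ ≤ C * (1 - lam ^ α)⁻¹ := mul_le_mul_of_nonneg_left (sum_le_hasSum _
        (fun i _ => pow_nonneg hθ0.le i) (hasSum_geometric_of_lt_one hθ0.le hθ1)) hC

end IsHolderWith

theorem IsLocal.isHolderWith (h0 : 0 < lam) (h1 : lam < 1) (hα : 0 ≤ α) {A : Y.carrier → ℝ}
    {M : ℝ} (hA : IsLocal n A) (hM : ∀ x, |A x| ≤ M) :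
    IsHolderWith lam α (2 * M / (lam ^ α) ^ n) A := fun x y => by
  have hM0 : 0 ≤ M := (abs_nonneg _).trans (hM x)
  have hdist := Real.rpow_nonneg (symDist_nonneg h0 x y) α
  by_cases h : Agree n x y
  · rw [hA h, sub_self, abs_zero]
    positivity
  · rw [div_mul_eq_mul_div, le_div_iff₀ (by positivity)]
    exact mul_le_mul ((abs_sub _ _).trans (by linarith [hM x, hM y]))
      (le_symDist_rpow_of_not_agree h0 h1 hα h) (by positivity) (by positivity)

end Holder

/-! ### Shadowing a periodic orbit -/

section Shadowing

variable {k N : ℕ} {p x : Y.carrier}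

/-- `x` follows the orbit of `p` for one step, as a walk on the graph of words of length `k`. -/
def IsNear (k : ℕ) (p x : Y.carrier) : Prop := ∃ i, Agree (k + 1) x ((sigma Y)^[i] p)

namespace OrbitSeparated

theorem agree_of_forall_isNear (hsep : OrbitSeparated k p) {L i : ℕ}
    (hi : Agree k x ((sigma Y)^[i] p)) (hnear : ∀ t < L, IsNear k p ((sigma Y)^[t] x)) :
    Agree (L + k) x ((sigma Y)^[i] p) := by
  induction L generalizing x i with
  | zero => rwa [zero_add]
  | succ L ih =>
    obtain ⟨j, hj⟩ : IsNear k p x := hnear 0 L.succ_pos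
    rw [← hsep (hi.symm.trans (hj.mono k.le_succ))] at hj
    have htail := ih (i := i + 1) (x := sigma Y x)
      (by rw [Function.iterate_succ_apply']; exact (hj.mono (add_comm 1 k).le).iterate (m := 1))
      fun t ht => hnear (t + 1) (Nat.succ_lt_succ ht)
    rw [Function.iterate_succ_apply'] at htail
    exact ((hj.mono (by omega)).append (m := 1) htail).mono (by omega)

theorem exists_eq_iterate (hsep : OrbitSeparated k p)
    (hnear : ∀ t, IsNear k p ((sigma Y)^[t] x)) : ∃ i, x = (sigma Y)^[i] p := by
  obtain ⟨i, hi⟩ := hnear 0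
  exact ⟨i, eq_of_forall_agree fun n => (hsep.agree_of_forall_isNear (hi.mono k.le_succ)
    (fun t (_ : t < n) => hnear t)).mono (n.le_add_right k)⟩

end OrbitSeparated

/-- The indicator function of the points which leave the orbit of `p` within one step. It is the
perturbation that turns a maximal orbit into a strictly maximal one. -/
def offOrbit (k : ℕ) (p : Y.carrier) : Y.carrier → ℝ := {x | IsNear k p x}ᶜ.indicator 1

theorem isLocal_offOrbit (k : ℕ) (p : Y.carrier) : IsLocal (k + 1) (offOrbit k p) :=
  fun x y h => by
    have hnear : IsNear k p x ↔ IsNear k p y :=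
      exists_congr fun _ => ⟨h.symm.trans, h.trans⟩
    classical
    simp [offOrbit, Set.indicator_apply, hnear]

theorem offOrbit_nonneg (k : ℕ) (p x : Y.carrier) : 0 ≤ offOrbit k p x :=
  Set.indicator_nonneg (fun _ _ => zero_le_one) x

theorem abs_offOrbit_le_one (k : ℕ) (p x : Y.carrier) : |offOrbit k p x| ≤ 1 := by
  rw [abs_of_nonneg (offOrbit_nonneg k p x)]
  exact Set.indicator_le_self' (fun _ _ => zero_le_one) x

theorem isNear_of_offOrbit_eq_zero (h : offOrbit k p x = 0) : IsNear k p x := by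
  simpa [offOrbit] using h

theorem birkhoffSum_offOrbit_self (k n : ℕ) (p : Y.carrier) :
    birkhoffSum (sigma Y) (offOrbit k p) n p = 0 :=
  Finset.sum_eq_zero fun i _ =>
    Set.indicator_of_notMem (Set.notMem_compl_iff.2 (.intro i (Agree.refl _ _))) _

theorem OrbitSeparated.exists_birkhoffSum_le_of_isHolderWith {lam α : ℝ} (h0 : 0 < lam)
    (h1 : lam < 1) (hα : 0 < α) (hN : 0 < N) (hp : IsPeriodicPt (sigma Y) N p)
    (hsep : OrbitSeparated k p) :
    ∃ E > 0, ∀ C ≥ 0, ∀ g : Y.carrier → ℝ, IsHolderWith lam α C g → ∀ n x,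
      birkhoffSum (sigma Y) g n x ≤ n * birkhoffAverage ℝ (sigma Y) g N p +
        C * E * (birkhoffSum (sigma Y) (offOrbit k p) n x + 1) := by
  have hθ : 0 < (1 - lam ^ α)⁻¹ := inv_pos.2 (sub_pos.2 (Real.rpow_lt_one h0.le h1 hα))
  refine ⟨(1 - lam ^ α)⁻¹ + N + 1, by positivity, fun C hC g hg n x => ?_⟩
  set β := birkhoffAverage ℝ (sigma Y) g N p with hβ
  have hholder := hg.sub_const β
  have hbound : ∀ x, |g x - β| ≤ C := fun x =>
    abs_sub_birkhoffAverage_le _ (hg.abs_sub_le h0 h1 hα.le hC) hN x p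
  have hperiod : birkhoffSum (sigma Y) (fun x => g x - β) N p = 0 := by
    rw [birkhoffSum_sub_const, hβ, natCast_mul_birkhoffAverage _ _ hN.ne', sub_self]
  have hrun : ∀ n x, (∀ t < n, (sigma Y)^[t] x ∈ {x | IsNear k p x}) →
      birkhoffSum (sigma Y) (fun x => g x - β) n x ≤ C * ((1 - lam ^ α)⁻¹ + N) := by
    intro n x hnear
    rcases n.eq_zero_or_pos with rfl | hn
    · rw [birkhoffSum_zero]
      positivity
    obtain ⟨i, hi⟩ := hnear 0 hn
    have hagree := hsep.agree_of_forall_isNear (hi.mono k.le_succ) hnear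
    have hdist := hholder.birkhoffSum_sub_le_of_agree h0 h1 hα hC (hagree.mono (n.le_add_right k))
    have horbit := abs_birkhoffSum_le_of_isPeriodicPt hbound hN (hp.apply_iterate i)
      ((birkhoffSum_iterate_of_isPeriodicPt hp _ i).trans hperiod) n
    rw [Function.iterate_zero_apply] at hdist
    linarith [le_of_abs_le horbit]
  have hsum := birkhoffSum_le_of_forall_mem (fun x => le_of_abs_le (hbound x)) hrun n x
  rw [birkhoffSum_sub_const] at hsum
  unfold offOrbit
  linarith

end Shadowing

/-! ### Measures on a periodic orbit -/

theorem continuous_sigma : Continuous (sigma Y) :=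
  (continuous_shift (1 : ℕ)).restrict _

section Measure

variable [MeasurableSpace S] {k N : ℕ} {p : Y.carrier} {μ : Measure Y.carrier} {B : Y.carrier → ℝ}

theorem orbitMeasure_apply (p : Y.carrier) (N : ℕ) {s : Set Y.carrier} (hs : MeasurableSet s) :
    orbitMeasure p N s = (N : ENNReal)⁻¹ * birkhoffSum (sigma Y) (s.indicator 1) N p := by
  simp [orbitMeasure, birkhoffSum, Measure.dirac_apply' _ hs]

theorem isInvariantProb_orbitMeasure (hσ : Measurable (sigma Y)) (hN : 0 < N)
    (hp : IsPeriodicPt (sigma Y) N p) : IsInvariantProb (orbitMeasure p N) := by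
  refine ⟨⟨?_⟩, hσ, Measure.ext fun s hs => ?_⟩
  · rw [orbitMeasure_apply p N MeasurableSet.univ]
    simpa [birkhoffSum] using ENNReal.inv_mul_cancel (Nat.cast_ne_zero.2 hN.ne')
      (ENNReal.natCast_ne_top N)
  · rw [Measure.map_apply hσ hs, orbitMeasure_apply p N hs, orbitMeasure_apply p N (hσ hs),
      ← birkhoffSum_apply_of_isPeriodicPt hp (s.indicator 1)]
    congr 1
    refine Finset.sum_congr rfl fun i _ => ?_
    rw [← Function.iterate_succ_apply, Function.iterate_succ_apply']
    rfl

theorem integral_orbitMeasure (p : Y.carrier) (N : ℕ) (hB : StronglyMeasurable B) :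
    ∫ x, B x ∂(orbitMeasure p N) = birkhoffAverage ℝ (sigma Y) B N p := by
  unfold orbitMeasure
  rw [integral_smul_measure, integral_finsetSum_measure]
  · simp [integral_dirac' _ _ hB, birkhoffSum, birkhoffAverage]
  · exact fun i _ => ⟨hB.aestronglyMeasurable, by
      rw [hasFiniteIntegral_iff_enorm, lintegral_dirac' _ hB.enorm]
      exact enorm_lt_top⟩

theorem IsInvariantProb.eq_orbitMeasure (hμ : IsInvariantProb μ) (hN : 0 < N)
    (hp : IsPeriodicPt (sigma Y) N p) (hsupp : ∀ᵐ x ∂μ, ∃ i, x = (sigma Y)^[i] p) :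
    μ = orbitMeasure p N := by
  obtain ⟨hprob, hinv⟩ := hμ
  have := (isInvariantProb_orbitMeasure hinv.measurable hN hp).1
  refine Measure.ext fun s hs => (measureReal_eq_measureReal_iff).1 ?_
  have hone : Integrable (s.indicator (1 : Y.carrier → ℝ)) μ := (integrable_const 1).indicator hs
  have hsum : ∀ᵐ x ∂μ, birkhoffSum (sigma Y) (s.indicator (1 : Y.carrier → ℝ)) N x =
      birkhoffSum (sigma Y) (s.indicator 1) N p := by
    filter_upwards [hsupp] with x ⟨i, hi⟩
    rw [hi, birkhoffSum_iterate_of_isPeriodicPt hp]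
  have hint := integral_birkhoffSum hinv hone N
  rw [integral_congr_ae hsum, integral_const, probReal_univ, one_smul,
    ← natCast_mul_birkhoffAverage _ _ hN.ne',
    ← integral_orbitMeasure p N (stronglyMeasurable_one.indicator hs)] at hint
  simpa only [integral_indicator_one hs] using
    (mul_left_cancel₀ (Nat.cast_ne_zero.2 hN.ne') hint).symm

variable [Finite S] [DiscreteTopology S] [BorelSpace S]

theorem IsInvariantProb.integrable (hμ : IsInvariantProb μ) (hB : Continuous B) :
    Integrable B μ := by
  have := hμ.1
  have : CompactSpace Y.carrier := isCompact_iff_compactSpace.1 Y.isClosed.isCompact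
  exact hB.integrable_of_hasCompactSupport (HasCompactSupport.of_compactSpace B)

theorem IsInvariantProb.eq_orbitMeasure_of_integral_offOrbit_eq_zero (hμ : IsInvariantProb μ)
    (hN : 0 < N) (hp : IsPeriodicPt (sigma Y) N p) (hsep : OrbitSeparated k p)
    (h : ∫ x, offOrbit k p x ∂μ = 0) : μ = orbitMeasure p N := by
  rw [integral_eq_zero_iff_of_nonneg (offOrbit_nonneg k p)
    (hμ.integrable (isLocal_offOrbit k p).continuous)] at h
  have hnear : ∀ᵐ x ∂μ, ∀ t, IsNear k p ((sigma Y)^[t] x) := ae_all_iff.2 fun t => by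
    filter_upwards [(hμ.2.iterate t).quasiMeasurePreserving.ae h] with x hx
    exact isNear_of_offOrbit_eq_zero hx
  refine hμ.eq_orbitMeasure hN hp ?_
  filter_upwards [hnear] with x hx
  exact hsep.exists_eq_iterate hx

theorem isMaximizing_iff_of_birkhoffSum_le (hN : 0 < N) (hp : IsPeriodicPt (sigma Y) N p)
    (hsep : OrbitSeparated k p) (hB : Continuous B) {c K : ℝ} (hc : 0 < c)
    (h : ∀ n x, birkhoffSum (sigma Y) (B + c • offOrbit k p) n x ≤
      n * birkhoffAverage ℝ (sigma Y) B N p + K) :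
    IsMaximizing B μ ↔ μ = orbitMeasure p N := by
  have horbit := isInvariantProb_orbitMeasure continuous_sigma.measurable hN hp
  have hoff : Continuous (offOrbit k p) := (isLocal_offOrbit k p).continuous
  have hle : ∀ ν, IsInvariantProb ν →
      ∫ x, B x ∂ν + c * ∫ x, offOrbit k p x ∂ν ≤ ∫ x, B x ∂(orbitMeasure p N) := fun ν hν => by
    have := hν.1
    rw [integral_orbitMeasure p N hB.measurable.stronglyMeasurable, ← integral_const_mul,
      ← integral_add (hν.integrable hB) ((hν.integrable hoff).const_mul c)]
    exact integral_le_of_birkhoffSum_le hν.2 (hν.integrable (hB.add (hoff.const_smul c))) h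
  have hoff_nonneg : ∀ ν : Measure Y.carrier, 0 ≤ ∫ x, offOrbit k p x ∂ν := fun _ =>
    integral_nonneg (offOrbit_nonneg k p)
  constructor
  · rintro ⟨hμ, hmax⟩
    refine hμ.eq_orbitMeasure_of_integral_offOrbit_eq_zero hN hp hsep
      (le_antisymm (nonpos_of_mul_nonpos_right ?_ hc) (hoff_nonneg μ))
    linarith [hle μ hμ, hmax _ horbit]
  · rintro rfl
    refine ⟨horbit, fun ν hν => ?_⟩
    linarith [hle ν hν, mul_nonneg hc.le (hoff_nonneg ν)]

end Measure

/-! ### Locking -/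

section Locking

variable [MeasurableSpace S] {lam α : ℝ} {k N : ℕ} {p : Y.carrier} {A D : Y.carrier → ℝ}

/-- The measure on the orbit of `p`, of period `N`, is the unique maximizing measure of `D` and of
all functions that differ from `D` by a function with a small Hölder constant. The difference need
not be small in the supremum norm, as maximizing measures do not change when a constant is added. -/
structure IsStablyLocked (lam α : ℝ) (D : Y.carrier → ℝ) (p : Y.carrier) (N : ℕ) : Prop where
  pos : 0 < N
  isPeriodicPt : IsPeriodicPt (sigma Y) N p
  exists_isMaximizing_iff : ∃ η > 0, ∀ B : Y.carrier → ℝ, IsHolderWith lam α η (B - D) →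
    ∀ μ, IsMaximizing B μ ↔ μ = orbitMeasure p N

theorem IsStablyLocked.sub_const (hD : IsStablyLocked lam α D p N) (c : ℝ) :
    IsStablyLocked lam α (fun x => D x - c) p N := by
  obtain ⟨hN, hp, η, hη, hlock⟩ := hD
  refine ⟨hN, hp, η, hη, fun B hB => hlock B ?_⟩
  convert hB.sub_const c using 2 with x
  simp only [Pi.sub_apply]
  ring

theorem isStablyLocked_sub_smul_offOrbit [Finite S] [DiscreteTopology S] [BorelSpace S]
    (h0 : 0 < lam) (h1 : lam < 1) (hα : 0 < α) (hN : 0 < N) (hp : IsPeriodicPt (sigma Y) N p)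
    (hsep : OrbitSeparated k p) (hA : IsLocal (k + 1) A) {K : ℝ}
    (hK : ∀ n x, birkhoffSum (sigma Y) A n x ≤ n * birkhoffAverage ℝ (sigma Y) A N p + K)
    {ε : ℝ} (hε : 0 < ε) : IsStablyLocked lam α (A - ε • offOrbit k p) p N := by
  obtain ⟨E, hE, hdev⟩ := hsep.exists_birkhoffSum_le_of_isHolderWith h0 h1 hα hN hp
  have hη : 0 < ε / (2 * E) := by positivity
  refine ⟨hN, hp, ε / (2 * E), hη, fun B hB μ => ?_⟩
  obtain ⟨g, rfl⟩ : ∃ g, B = A - ε • offOrbit k p + g := ⟨_, (add_sub_cancel _ B).symm⟩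
  rw [add_sub_cancel_left] at hB
  have hcont := (hA.sub ((isLocal_offOrbit k p).const_smul ε)).continuous.add
    (hB.continuous h0 h1 hα hη.le)
  refine isMaximizing_iff_of_birkhoffSum_le hN hp hsep hcont (half_pos hε) (K := K + ε / 2)
    fun n x => ?_
  have hmean : birkhoffAverage ℝ (sigma Y) (A - ε • offOrbit k p + g) N p =
      birkhoffAverage ℝ (sigma Y) A N p + birkhoffAverage ℝ (sigma Y) g N p := by
    simp only [birkhoffAverage, birkhoffSum_add', birkhoffSum_sub, birkhoffSum_const_smul,
      birkhoffSum_offOrbit_self, mul_zero, sub_zero, smul_add]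
  have hdevx := hdev _ hη.le g hB n x
  rw [show ε / (2 * E) * E = ε / 2 by field_simp] at hdevx
  rw [hmean, birkhoffSum_add', birkhoffSum_add', birkhoffSum_sub, birkhoffSum_const_smul,
    birkhoffSum_const_smul]
  linarith [hK n x]

theorem HasMemory.exists_isStablyLocked_sub_smul [Finite S] [Nonempty Y.carrier]
    [DiscreteTopology S] [BorelSpace S] (h0 : 0 < lam) (h1 : lam < 1) (hα : 0 < α)
    (hk : HasMemory Y k) (hA : IsLocal (k + 1) A) :
    ∃ p N, ∀ ε : ℝ, 0 < ε → IsStablyLocked lam α (A - ε • offOrbit k p) p N := by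
  obtain ⟨p, N, hN, hp, hsep, K, hK⟩ := hk.exists_dominating_cycle hA
  exact ⟨p, N, fun ε hε => isStablyLocked_sub_smul_offOrbit h0 h1 hα hN hp hsep hA hK hε⟩

end Locking

/-! ### Pressure -/

section Pressure

variable {lam c : ℝ} {A B : Y.carrier → ℝ}

theorem partitionSup_le_of_le_const_add (h : ∀ x, B x ≤ c + A x) (n : ℕ) (ε : ℝ) :
    partitionSup lam B n ε ≤ ENNReal.ofReal (Real.exp (n * c)) * partitionSup lam A n ε := by
  have hsum : ∀ x, birkhoffSum (sigma Y) B n x ≤ n * c + birkhoffSum (sigma Y) A n x := fun x => by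
    refine (Finset.sum_le_sum fun i _ => h _).trans_eq ?_
    simp [birkhoffSum, Finset.sum_add_distrib]
  refine iSup₂_le fun E hE => ?_
  calc ∑ x ∈ E, ENNReal.ofReal (Real.exp (birkhoffSum (sigma Y) B n x))
      ≤ ∑ x ∈ E, ENNReal.ofReal (Real.exp (n * c)) *
          ENNReal.ofReal (Real.exp (birkhoffSum (sigma Y) A n x)) :=
        Finset.sum_le_sum fun x _ => by
          rw [← ENNReal.ofReal_mul (Real.exp_nonneg _), ← Real.exp_add]
          exact ENNReal.ofReal_le_ofReal (Real.exp_le_exp.2 (hsum x))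
    _ ≤ ENNReal.ofReal (Real.exp (n * c)) * partitionSup lam A n ε := by
        rw [← Finset.mul_sum]
        exact mul_le_mul_right (le_iSup₂ (f := fun (E : Finset Y.carrier)
          (_ : IsSeparated lam n ε E) =>
            ∑ x ∈ E, ENNReal.ofReal (Real.exp (birkhoffSum (sigma Y) A n x))) E hE) _

theorem log_partitionSup_div_le_of_le_const_add (h : ∀ x, B x ≤ c + A x) {n : ℕ} (hn : 0 < n)
    (ε : ℝ) : ENNReal.log (partitionSup lam B n ε) / (n : EReal) ≤
      c + ENNReal.log (partitionSup lam A n ε) / (n : EReal) := by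
  have hdiv : ((n * c : ℝ) : EReal) / (n : EReal) = c := by
    rw [← EReal.coe_natCast, ← EReal.coe_div,
      mul_div_cancel_left₀ _ (Nat.cast_ne_zero.2 hn.ne')]
  have hlog := EReal.div_le_div_right_of_nonneg (c := (n : EReal)) n.cast_nonneg'
    (ENNReal.log_le_log (partitionSup_le_of_le_const_add (lam := lam) h n ε))
  rwa [ENNReal.log_mul_add, ENNReal.log_ofReal_of_pos (Real.exp_pos _), Real.log_exp,
    EReal.add_div_of_nonneg_right n.cast_nonneg', hdiv] at hlog

theorem pressure_le_of_le_const_add (h : ∀ x, B x ≤ c + A x) :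
    pressure lam B ≤ c + pressure lam A := by
  refine iSup₂_le fun ε hε => ?_
  let rate : (Y.carrier → ℝ) → ℕ → EReal := fun A n =>
    ENNReal.log (partitionSup lam A n ε) / (n : EReal)
  have hconst : limsup (fun _ : ℕ => (c : EReal)) atTop = c := limsup_const _
  calc limsup (rate B) atTop
      ≤ limsup ((fun _ : ℕ => (c : EReal)) + rate A) atTop :=
        limsup_le_limsup <| (eventually_gt_atTop 0).mono fun n hn =>
          log_partitionSup_div_le_of_le_const_add h hn ε
    _ ≤ c + limsup (rate A) atTop := by
        refine (EReal.limsup_add_le (.inl ?_) (.inl ?_)).trans_eq (by rw [hconst])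
        · exact hconst.trans_ne (EReal.coe_ne_bot c)
        · exact hconst.trans_ne (EReal.coe_ne_top c)
    _ ≤ c + pressure lam A := add_le_add_right (le_iSup₂ (f := fun (ε : ℝ) (_ : 0 < ε) =>
        limsup (fun n : ℕ => ENNReal.log (partitionSup lam A n ε) / (n : EReal)) atTop) ε hε) _

theorem pressure_sub_const (lam : ℝ) (A : Y.carrier → ℝ) (c : ℝ) :
    pressure lam (fun x => A x - c) = pressure lam A - c := by
  refine le_antisymm ?_ (EReal.sub_le_of_le_add' (pressure_le_of_le_const_add fun x => by simp))
  rw [sub_eq_add_neg, add_comm, ← EReal.coe_neg]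
  exact pressure_le_of_le_const_add fun x => (neg_add_eq_sub c (A x)).ge

theorem exists_pressure_eq_coe {a δ : ℝ} (hA : pressure lam A = a) (h : ∀ x, |B x - A x| ≤ δ) :
    ∃ b : ℝ, pressure lam B = b ∧ |b - a| ≤ δ := by
  have hle : pressure lam B ≤ (δ + a : ℝ) := by
    rw [EReal.coe_add, ← hA]
    exact pressure_le_of_le_const_add fun x => by linarith [le_of_abs_le (h x)]
  have hge : (a : EReal) ≤ δ + pressure lam B := by
    rw [← hA]
    exact pressure_le_of_le_const_add fun x => by linarith [neg_le_of_abs_le (h x)]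
  have hbot : pressure lam B ≠ ⊥ := fun hb => by simp [hb] at hge
  obtain ⟨b, hb⟩ : ∃ b : ℝ, (b : EReal) = pressure lam B :=
    ⟨_, EReal.coe_toReal (hle.trans_lt (EReal.coe_lt_top _)).ne hbot⟩
  rw [← hb] at hle hge
  norm_cast at hle hge
  exact ⟨b, hb.symm, abs_le.2 ⟨by linarith, by linarith⟩⟩

theorem nonempty_of_pressure_eq_coe {a : ℝ} (hA : pressure lam A = a) : Nonempty Y.carrier := by
  by_contra hempty
  have := not_nonempty_iff.1 hempty
  have hsub := pressure_sub_const lam A 1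
  rw [Subsingleton.elim (fun x => A x - 1) A, hA] at hsub
  norm_cast at hsub
  linarith

end Pressure

/-! ### Approximation by functions of finitely many letters -/

section Approximation

variable {lam α γ C : ℝ} {A : Y.carrier → ℝ}

theorem exists_cylinder_representative (n : ℕ) : ∃ ρ : Y.carrier → Y.carrier,
    (∀ x, Agree n (ρ x) x) ∧ ∀ ⦃x y⦄, Agree n x y → ρ x = ρ y :=
  ⟨fun x => (Quotient.mk (Setoid.ker (word n)) x).out,
    fun x => word_eq_word_iff.1 (Quotient.mk_out (s := Setoid.ker (word n)) x),
    fun _ _ h => congrArg Quotient.out (Quotient.sound (word_eq_word_iff.2 h))⟩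

theorem IsHolderWith.exists_isLocal (h0 : 0 < lam) (h1 : lam < 1) (hα : 0 ≤ α) (hγ : α ≤ γ)
    (hC : 0 ≤ C) (hA : IsHolderWith lam γ C A) (n : ℕ) :
    ∃ B : Y.carrier → ℝ, IsLocal n B ∧ (∀ x, |B x - A x| ≤ C * (lam ^ (γ - α)) ^ n) ∧
      IsHolderWith lam α (2 * C * (lam ^ (γ - α)) ^ n) (B - A) := by
  obtain ⟨ρ, hρ, hρ_eq⟩ := exists_cylinder_representative (Y := Y) n
  have hγα : 0 ≤ γ - α := sub_nonneg.2 hγ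
  have hpow : (lam ^ γ) ^ n = (lam ^ (γ - α)) ^ n * (lam ^ α) ^ n := by
    rw [← mul_pow, ← Real.rpow_add h0, sub_add_cancel]
  have hclose : ∀ x, |A (ρ x) - A x| ≤ C * (lam ^ (γ - α)) ^ n * (lam ^ α) ^ n := fun x => by
    rw [mul_assoc, ← hpow]
    exact hA.abs_sub_le_of_agree h0 h1 (hα.trans hγ) hC (hρ x)
  refine ⟨fun x => A (ρ x), fun x y h => congrArg A (hρ_eq h), fun x => ?_, fun x y => ?_⟩
  · exact (hclose x).trans (mul_le_of_le_one_right (by positivity)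
      (pow_le_one₀ (by positivity) (Real.rpow_le_one h0.le h1.le hα)))
  have hdist := symDist_nonneg h0 x y
  simp only [Pi.sub_apply]
  by_cases h : Agree n x y
  · rw [hρ_eq h, sub_sub_sub_cancel_left, abs_sub_comm]
    calc |A x - A y| ≤ C * (symDist lam x y ^ (γ - α) * symDist lam x y ^ α) := by
          rw [← Real.rpow_add_of_nonneg hdist hγα hα, sub_add_cancel]
          exact hA x y
      _ ≤ C * ((lam ^ (γ - α)) ^ n * symDist lam x y ^ α) := by
          gcongr
          exact h.symDist_rpow_le h0 h1 hγα
      _ ≤ 2 * C * (lam ^ (γ - α)) ^ n * symDist lam x y ^ α := by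
          rw [mul_assoc, mul_assoc]
          exact le_mul_of_one_le_left (by positivity) one_le_two
  · calc |A (ρ x) - A x - (A (ρ y) - A y)| ≤ |A (ρ x) - A x| + |A (ρ y) - A y| := abs_sub _ _
      _ ≤ 2 * C * (lam ^ (γ - α)) ^ n * (lam ^ α) ^ n := by linarith [hclose x, hclose y]
      _ ≤ 2 * C * (lam ^ (γ - α)) ^ n * symDist lam x y ^ α := by
          gcongr
          exact le_symDist_rpow_of_not_agree h0 h1 hα h

theorem eventually_exists_isLocal (h0 : 0 < lam) (h1 : lam < 1) (hα : 0 ≤ α) (hγ : α < γ)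
    (hA : A ∈ holderSubmodule Y lam γ) {δ : ℝ} (hδ : 0 < δ) :
    ∀ᶠ n in atTop, ∃ B : Y.carrier → ℝ, IsLocal n B ∧ (∀ x, |B x - A x| ≤ δ) ∧
      IsHolderWith lam α δ (B - A) := by
  obtain ⟨C, hC, hAC⟩ := exists_isHolderWith hA h0
  have hlim : Tendsto (fun n => 2 * C * (lam ^ (γ - α)) ^ n) atTop (𝓝 0) := by
    simpa using (tendsto_pow_atTop_nhds_zero_of_lt_one (Real.rpow_nonneg h0.le _)
      (Real.rpow_lt_one h0.le h1 (sub_pos.2 hγ))).const_mul (2 * C)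
  filter_upwards [hlim.eventually_lt_const hδ] with n hn
  obtain ⟨B, hB, hBA, hBAα⟩ := hAC.exists_isLocal h0 h1 hα hγ.le hC n
  have hle : C * (lam ^ (γ - α)) ^ n ≤ 2 * C * (lam ^ (γ - α)) ^ n := by
    rw [mul_assoc]
    exact le_mul_of_one_le_left (by positivity) one_le_two
  exact ⟨B, hB, fun x => (hBA x).trans (hle.trans hn.le), hBAα.mono h0 hn.le⟩

theorem exists_isStablyLocked_near [Finite S] [Nonempty Y.carrier] [DiscreteTopology S]
    [MeasurableSpace S] [BorelSpace S] (h0 : 0 < lam) (h1 : lam < 1) (hα : 0 < α) (hγ : α < γ)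
    (hY : ∀ᶠ k in atTop, HasMemory Y k) (hA : A ∈ holderSubmodule Y lam γ) {δ : ℝ} (hδ : 0 < δ) :
    ∃ n D p N, IsLocal n D ∧ IsStablyLocked lam α D p N ∧ (∀ x, |D x - A x| ≤ δ) ∧
      IsHolderWith lam α δ (D - A) := by
  obtain ⟨k, hk, B, hB, hBA, hBAα⟩ := (hY.and ((tendsto_add_atTop_nat 1).eventually
    (eventually_exists_isLocal h0 h1 hα.le hγ hA (half_pos hδ)))).exists
  obtain ⟨p, N, hlock⟩ := hk.exists_isStablyLocked_sub_smul h0 h1 hα hB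
  set θ := lam ^ α
  have hθ : 0 < θ := Real.rpow_pos_of_pos h0 α
  have hθk : θ ^ (k + 1) ≤ 1 := pow_le_one₀ hθ.le (Real.rpow_le_one h0.le h1.le hα.le)
  set ε := δ / 4 * θ ^ (k + 1) with hε_def
  have hε : 0 < ε := by positivity
  have hεδ : ε ≤ δ / 4 := mul_le_of_le_one_right (by positivity) hθk
  have hsmall : ∀ x, |ε * offOrbit k p x| ≤ ε := fun x => by
    rw [abs_mul, abs_of_pos hε]
    exact mul_le_of_le_one_right hε.le (abs_offOrbit_le_one k p x)
  have hlocal := (isLocal_offOrbit k p).const_smul ε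
  have hsum : δ / 2 + 2 * ε / θ ^ (k + 1) = δ := by
    rw [hε_def]
    field_simp
    norm_num
  refine ⟨k + 1, _, p, N, hB.sub hlocal, hlock ε hε, fun x => ?_, ?_⟩
  · rw [Pi.sub_apply, Pi.smul_apply, smul_eq_mul, sub_right_comm]
    linarith [abs_sub (B x - A x) (ε * offOrbit k p x), hBA x, hsmall x]
  · rw [sub_right_comm, ← hsum]
    exact hBAα.sub (hlocal.isHolderWith h0 h1 hα.le hsmall)

end Approximation

/-! ### The locked functions form an open dense set -/

section HolderNorm

variable {lam α : ℝ}

theorem norm_le_of_isHolderWith {A : HolderSpace Y lam α} {C M : ℝ} (hC : 0 ≤ C) (hM : 0 ≤ M)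
    (hA : ∀ x, |A x| ≤ M) (hAα : IsHolderWith lam α C A) : ‖A‖ ≤ C + M :=
  add_le_add
    (Real.iSup_le (fun p => (div_le_iff₀ (Real.rpow_pos_of_pos p.2.1 α)).2 (hAα _ _)) hC)
    (Real.iSup_le hA hM)

theorem isHolderWith_norm (h0 : 0 < lam) (h1 : lam < 1) (A : HolderSpace Y lam α) :
    IsHolderWith lam α ‖A‖ A := fun x y => by
  rcases eq_or_ne x y with rfl | hxy
  · rw [sub_self, abs_zero]
    exact mul_nonneg (norm_nonneg A) (Real.rpow_nonneg (symDist_nonneg h0 x x) α)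
  · have hpos : 0 < symDist lam x y := by
      rw [symDist, if_neg hxy]
      positivity
    rw [← div_le_iff₀ (Real.rpow_pos_of_pos hpos α)]
    exact (le_ciSup (bddAbove_hold A) ⟨(x, y), hpos, symDist_le_one h0 h1 x y⟩).trans
      (le_add_of_nonneg_right (supNorm_nonneg _))

theorem IsLocal.mem_holderSubmodule [Finite S] {n : ℕ} {A : Y.carrier → ℝ} (h0 : 0 < lam)
    (h1 : lam < 1) (hα : 0 ≤ α) (hA : IsLocal n A) : A ∈ holderSubmodule Y lam α := by
  obtain ⟨M, hM⟩ := hA.exists_abs_le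
  exact ⟨⟨M, hM⟩, _, hA.isHolderWith h0 h1 hα hM⟩

end HolderNorm

section Locked

variable [MeasurableSpace S] {lam α : ℝ}

theorem IsStablyLocked.mem_periodicLocked (h0 : 0 < lam) (h1 : lam < 1)
    {D : holderPlusZero Y lam α} {p : Y.carrier} {N : ℕ}
    (hD : IsStablyLocked lam α (D.1 : Y.carrier → ℝ) p N) : D ∈ periodicLocked Y lam α := by
  obtain ⟨hN, hp, η, hη, hlock⟩ := hD
  refine ⟨p, N, hN, hp, Metric.ball D η, Metric.ball_mem_nhds D hη, fun B hB => hlock _ ?_⟩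
  have hBD : ‖B.1 - D.1‖ ≤ η := by
    rw [← dist_eq_norm]
    exact (Metric.mem_ball.1 hB).le
  exact (isHolderWith_norm h0 h1 (B.1 - D.1)).mono h0 hBD

theorem isOpen_periodicLocked (Y : Subshift S ℕ) (lam α : ℝ) :
    IsOpen (periodicLocked Y lam α) := by
  refine isOpen_iff_mem_nhds.2 fun A ⟨p, N, hN, hp, U, hU, hlock⟩ => ?_
  filter_upwards [eventually_mem_nhds_iff.2 hU] with B hB
  exact ⟨p, N, hN, hp, U, hB, hlock⟩

theorem exists_mem_periodicLocked_norm_sub_le [Finite S] [Inhabited S] [DiscreteTopology S]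
    [BorelSpace S] (hY : IsFiniteType Y) (h0 : 0 < lam) (h1 : lam < 1) (hα : 0 < α) {γ : ℝ}
    (hγ : α < γ) {A : HolderSpace Y lam α} (hA : (A : Y.carrier → ℝ) ∈ holderSubmodule Y lam γ)
    (hP : pressure lam A = 0) {δ : ℝ} (hδ : 0 < δ) :
    ∃ D ∈ periodicLocked Y lam α, ‖D.1 - A‖ ≤ 3 * δ := by
  have := nonempty_of_pressure_eq_coe hP
  obtain ⟨n, D, p, N, hlocal, hlock, hDA, hDAα⟩ :=
    exists_isStablyLocked_near h0 h1 hα hγ hY.eventually_hasMemory hA hδ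
  obtain ⟨r, hr, hrδ⟩ := exists_pressure_eq_coe hP hDA
  rw [sub_zero] at hrδ
  have hpressure : pressure lam (fun x => D x - r) = 0 := by
    rw [pressure_sub_const, hr, ← EReal.coe_sub, sub_self, EReal.coe_zero]
  have hmem : ∀ γ', 0 ≤ γ' → (fun x => D x - r) ∈ holderSubmodule Y lam γ' := fun _ hγ' =>
    (hlocal.sub_const r).mem_holderSubmodule h0 h1 hγ'
  let D' : holderPlusZero Y lam α := ⟨⟨fun x => D x - r, hmem α hα.le⟩,
    subset_closure ⟨γ, hγ, hmem γ (hα.le.trans hγ.le), hpressure⟩⟩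
  have hcoe : (D'.1 - A : HolderSpace Y lam α).1 = fun x => (D - A.1) x - r := by
    funext x
    exact sub_right_comm (D x) r (A x)
  refine ⟨D', (hlock.sub_const r).mem_periodicLocked h0 h1, ?_⟩
  calc ‖D'.1 - A‖ ≤ δ + 2 * δ := norm_le_of_isHolderWith hδ.le (by positivity)
        (fun x => by
          rw [hcoe, two_mul]
          exact (abs_sub _ _).trans (add_le_add (hDA x) hrδ))
        (by rw [hcoe]; exact hDAα.sub_const r)
    _ = 3 * δ := by ring

theorem dense_periodicLocked [Finite S] [Inhabited S] [DiscreteTopology S] [BorelSpace S]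
    (hY : IsFiniteType Y) (h0 : 0 < lam) (h1 : lam < 1) (hα : 0 < α) :
    Dense (periodicLocked Y lam α) := fun A => by
  refine Metric.mem_closure_iff.2 fun ε hε => ?_
  obtain ⟨A₁, ⟨γ, hγ, hA₁, hP⟩, hAA₁⟩ := Metric.mem_closure_iff.1 A.2 (ε / 2) (half_pos hε)
  obtain ⟨D, hD, hDA₁⟩ :=
    exists_mem_periodicLocked_norm_sub_le hY h0 h1 hα hγ hA₁ hP (δ := ε / 8) (by positivity)
  refine ⟨D, hD, ?_⟩
  calc dist A.1 D.1 ≤ dist A.1 A₁ + ‖D.1 - A₁‖ := by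
        rw [← dist_eq_norm, dist_comm D.1]
        exact dist_triangle _ _ _
    _ < ε := by linarith

end Locked

end HolderShift

end

theorem theoremB_general {S : Type*} [Finite S] [Inhabited S] [TopologicalSpace S]
    [DiscreteTopology S] [MeasurableSpace S] [BorelSpace S]
    (Y : Subshift S ℕ) (hY : HolderShift.IsFiniteType Y)
    (lam : ℝ) (hlam0 : 0 < lam) (hlam1 : lam < 1) (α : ℝ) (hα0 : 0 < α) :
    IsOpen (HolderShift.periodicLocked Y lam α) ∧
      Dense (HolderShift.periodicLocked Y lam α) :=
  ⟨HolderShift.isOpen_periodicLocked Y lam α,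
    HolderShift.dense_periodicLocked hY hlam0 hlam1 hα0⟩

theorem theoremB {S : Type*} [Finite S] [Inhabited S] [TopologicalSpace S] [DiscreteTopology S]
    [MeasurableSpace S] [BorelSpace S]
    (Y : Subshift S ℕ) (hY : HolderShift.IsFiniteType Y)
    (hmix : HolderShift.TopologicallyMixing (HolderShift.sigma Y))
    (lam : ℝ) (hlam0 : 0 < lam) (hlam1 : lam < 1) (α : ℝ) (hα0 : 0 < α) (hα1 : α ≤ 1) :
    IsOpen (HolderShift.periodicLocked Y lam α) ∧
      Dense (HolderShift.periodicLocked Y lam α) :=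
  theoremB_general Y hY lam hlam0 hlam1 α hα0
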